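/- Let $P=(X,\prec)$ be a finite partially ordered set with $|X|=n$ elements, and let $x\in X$. A linear extension of $P$ is a bijection $f:X\to\{1,\dots,n\}$ such that $y\prec z$ implies $f(y)<f(z)$ for all $y,z\in X$. Let $\mathbb{P}$ denote the probability over a uniformly random linear extension $f$ of $P$. Then for every integer $k$ with $1\le k\le n-1$, $$\mathbb{P}[f(x)>k]^2\ \ge\ \mathbb{P}[f(x)>k-1]\cdot\mathbb{P}[f(x)>k+1].$$ Moreover, $$\mathbb{P}[f(x)=1]\cdot\mathbb{P}[f(x)>1]\ \le\ \mathbb{P}[f(x)=2].$$ -/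

import Mathlib

/-- The set of linear extensions of a finite poset `X` with `n` elements: the bijections
`f : X → {1, …, n}` such that `x < y` implies `f x < f y`. -/
def linearExtensions (X : Type*) [PartialOrder X] [Fintype X] : Set (X → ℕ) :=
  {f | Set.BijOn f Set.univ (Set.Icc 1 (Fintype.card X)) ∧ ∀ x y : X, x < y → f x < f y}

/-- The law of a uniformly random linear extension of `X`. -/
noncomputable def linExtLaw (X : Type*) [PartialOrder X] [Fintype X] :
    MeasureTheory.Measure (X → ℕ) :=
  ProbabilityTheory.uniformOn (linearExtensions X)

/-! Read a linear extension as the word listing `X` by increasing value. Then `f x > k` says that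
the first `k` letters lie in `L = {z | ¬ x ≤ z}`, so the number of such extensions is `N k = wordSum
L completions k ∅`: choose `k` letters from `L`, then complete freely. Both claims reduce to `N k *
N (k + 2) ≤ N (k + 1) ^ 2`.

These three numbers are the values of one symmetric bilinear form, `borderedMatrix`, on the all-ones
vector on letters and the border vector. The inequality is the reversed Cauchy-Schwarz inequality,
valid once the form is Lorentzian (`borderedMatrix_wordSum_isLorentzian`).

The Lorentzian property is propagated by induction, in the manner of a combinatorial atlas.
`Matrix.isLorentzian_of_inheritance` passes it from matrices `A i` to `B` when the rows of `B` are
read off from the `A i` and the form of `B` is at most a weighted sum of theirs. For word counts,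
the second condition is `letterForm_le_sum`, where the difference of the two sides is a sum of
squares. The induction for unrestricted words starts when two letters remain; restricted words are
then reduced to it by a linear change of variables. -/

open Matrix in
/-- A real square matrix, seen as a quadratic form, is Lorentzian if no plane on which it is
positive definite exists. -/
def Matrix.IsLorentzian {ι : Type*} [Fintype ι] (A : Matrix ι ι ℝ) : Prop :=
  ∀ v w : ι → ℝ, 0 < w ⬝ᵥ A *ᵥ w → ∃ s : ℝ, (v - s • w) ⬝ᵥ A *ᵥ (v - s • w) ≤ 0

/-! ### Lorentzian forms and their inheritance. -/

section Lorentzian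

open Matrix

variable {ι : Type*} [Fintype ι]

theorem Matrix.IsSymm.dotProduct_mulVec_comm {A : Matrix ι ι ℝ} (hA : A.IsSymm) (v w : ι → ℝ) :
    v ⬝ᵥ A *ᵥ w = w ⬝ᵥ A *ᵥ v := by
  rw [dotProduct_mulVec, dotProduct_comm, ← mulVec_transpose, hA.eq]

theorem Matrix.IsSymm.dotProduct_mulVec_sub_smul {A : Matrix ι ι ℝ} (hA : A.IsSymm)
    (v w : ι → ℝ) (s : ℝ) :
    (v - s • w) ⬝ᵥ A *ᵥ (v - s • w) =
      v ⬝ᵥ A *ᵥ v - 2 * s * (v ⬝ᵥ A *ᵥ w) + s ^ 2 * (w ⬝ᵥ A *ᵥ w) := by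
  have := hA.dotProduct_mulVec_comm v w
  simp only [mulVec_sub, mulVec_smul, dotProduct_sub, sub_dotProduct, smul_dotProduct,
    dotProduct_smul, smul_eq_mul]
  rw [← this]; ring

/-- The reversed Cauchy-Schwarz inequality. -/
theorem Matrix.IsLorentzian.mul_le_sq {A : Matrix ι ι ℝ} (h : A.IsLorentzian) (hA : A.IsSymm)
    (v w : ι → ℝ) (hw : 0 ≤ w ⬝ᵥ A *ᵥ w) :
    (v ⬝ᵥ A *ᵥ v) * (w ⬝ᵥ A *ᵥ w) ≤ (v ⬝ᵥ A *ᵥ w) ^ 2 := by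
  rcases hw.eq_or_lt with h0 | h0
  · rw [← h0, mul_zero]; positivity
  · obtain ⟨s, hs⟩ := h v w h0
    rw [hA.dotProduct_mulVec_sub_smul] at hs
    nlinarith [sq_nonneg (v ⬝ᵥ A *ᵥ w - s * (w ⬝ᵥ A *ᵥ w))]

theorem Matrix.isLorentzian_of_mul_le_sq {A : Matrix ι ι ℝ} (hA : A.IsSymm)
    (h : ∀ v w : ι → ℝ, 0 < w ⬝ᵥ A *ᵥ w →
      (v ⬝ᵥ A *ᵥ v) * (w ⬝ᵥ A *ᵥ w) ≤ (v ⬝ᵥ A *ᵥ w) ^ 2) : A.IsLorentzian := by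
  intro v w hw
  refine ⟨(v ⬝ᵥ A *ᵥ w) / (w ⬝ᵥ A *ᵥ w), ?_⟩
  rw [hA.dotProduct_mulVec_sub_smul]
  have := h v w hw
  have h2 : v ⬝ᵥ A *ᵥ v ≤ (v ⬝ᵥ A *ᵥ w) ^ 2 / (w ⬝ᵥ A *ᵥ w) := by rwa [le_div_iff₀ hw]
  have h3 : v ⬝ᵥ A *ᵥ v - 2 * ((v ⬝ᵥ A *ᵥ w) / (w ⬝ᵥ A *ᵥ w)) * (v ⬝ᵥ A *ᵥ w) +
      ((v ⬝ᵥ A *ᵥ w) / (w ⬝ᵥ A *ᵥ w)) ^ 2 * (w ⬝ᵥ A *ᵥ w) =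
      v ⬝ᵥ A *ᵥ v - (v ⬝ᵥ A *ᵥ w) ^ 2 / (w ⬝ᵥ A *ᵥ w) := by
    field_simp; ring
  linarith

theorem Matrix.isLorentzian_of_nonpos_orthogonal {A : Matrix ι ι ℝ} (h : ι → ℝ)
    (hA0 : ∀ v : ι → ℝ, v ⬝ᵥ A *ᵥ h = 0 → v ⬝ᵥ A *ᵥ v ≤ 0) : A.IsLorentzian := by
  intro v w hw
  have hwh : w ⬝ᵥ A *ᵥ h ≠ 0 := fun h0 => (hA0 w h0).not_gt hw
  refine ⟨(v ⬝ᵥ A *ᵥ h) / (w ⬝ᵥ A *ᵥ h), hA0 _ ?_⟩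
  rw [sub_dotProduct, smul_dotProduct, smul_eq_mul, div_mul_cancel₀ _ hwh, sub_self]

theorem Matrix.apply_eq_zero_of_mulVec_eq_zero {A : Matrix ι ι ℝ} (hnn : ∀ i j, 0 ≤ A i j)
    {h : ι → ℝ} (hpos : ∀ i, 0 < h i) {i : ι} (hi : (A *ᵥ h) i = 0) (j : ι) : A i j = 0 := by
  have := (Finset.sum_eq_zero_iff_of_nonneg
    (fun j _ => mul_nonneg (hnn i j) (hpos j).le)).1 hi j (Finset.mem_univ j)
  exact (mul_eq_zero.1 this).resolve_right (hpos j).ne'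

theorem Matrix.mulVec_nonneg {A : Matrix ι ι ℝ} (hnn : ∀ i j, 0 ≤ A i j)
    {h : ι → ℝ} (hpos : ∀ i, 0 < h i) (i : ι) : 0 ≤ (A *ᵥ h) i :=
  Finset.sum_nonneg fun j _ => mul_nonneg (hnn i j) (hpos j).le

/-- The right side is the energy of `v / h` on the graph with edge weights `B i j * h i * h j`. For
`B ≥ 0` it is nonnegative, and it vanishes only if `v / h` is constant along edges. -/
theorem Matrix.laplacian_identity {B : Matrix ι ι ℝ} (hB : B.IsSymm) {h : ι → ℝ}
    (hpos : ∀ i, 0 < h i) (v : ι → ℝ) :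
    2 * (∑ i, (B *ᵥ h) i / h i * v i ^ 2 - v ⬝ᵥ B *ᵥ v) =
      ∑ i, ∑ j, B i j * h i * h j * (v i / h i - v j / h j) ^ 2 := by
  have h1 : ∀ i j, B i j * h i * h j * (v i / h i - v j / h j) ^ 2 =
      B i j * h j / h i * v i ^ 2 + B j i * h i / h j * v j ^ 2 - 2 * (v i * (B i j * v j)) := by
    intro i j
    have hi := (hpos i).ne'
    have hj := (hpos j).ne'
    rw [hB.apply i j]
    field_simp
    ring
  have h2 : ∑ i, (B *ᵥ h) i / h i * v i ^ 2 = ∑ i, ∑ j, B i j * h j / h i * v i ^ 2 := by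
    simp [mulVec, dotProduct, Finset.sum_div, Finset.sum_mul]
  have h3 : v ⬝ᵥ B *ᵥ v = ∑ i, ∑ j, v i * (B i j * v j) := by
    simp [mulVec, dotProduct, Finset.mul_sum]
  have h4 : ∑ i, ∑ j, B j i * h i / h j * v j ^ 2 = ∑ i, ∑ j, B i j * h j / h i * v i ^ 2 :=
    Finset.sum_comm
  simp only [h1, Finset.sum_sub_distrib, Finset.sum_add_distrib, ← Finset.mul_sum]
  rw [h4, h2, h3]
  simp only [← Finset.mul_sum]
  ring

/-- A symmetric matrix whose eigenvalues are nonpositive or equal to one on a line. -/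
theorem Matrix.nonpos_of_eigen [DecidableEq ι] {C : Matrix ι ι ℝ} (hC : C.IsSymm) (p : ι → ℝ)
    (h1 : ∀ u, u ⬝ᵥ C *ᵥ u ≤ (C *ᵥ u) ⬝ᵥ (C *ᵥ u)) (h2 : ∀ u, u ⬝ᵥ C *ᵥ u ≤ u ⬝ᵥ u)
    (h3 : ∀ u, C *ᵥ u = u → ∃ c : ℝ, u = c • p) (u : ι → ℝ) (hu : u ⬝ᵥ p = 0) :
    u ⬝ᵥ C *ᵥ u ≤ 0 := by
  have hH : C.IsHermitian := by
    rw [Matrix.IsHermitian, conjTranspose_eq_transpose_of_trivial]; exact hC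
  set b := hH.eigenvectorBasis
  set l := hH.eigenvalues
  have hb : ∀ i, C *ᵥ (b i).ofLp = l i • (b i).ofLp := hH.mulVec_eigenvectorBasis
  have hbb : ∀ i, (b i).ofLp ⬝ᵥ (b i).ofLp = 1 := by
    intro i
    have := b.orthonormal.1 i
    have h2 := EuclideanSpace.inner_eq_star_dotProduct (𝕜 := ℝ) (b i) (b i)
    rw [real_inner_self_eq_norm_sq, this] at h2
    simpa using h2.symm
  have hexp : u ⬝ᵥ C *ᵥ u = ∑ i, l i * ((b i).ofLp ⬝ᵥ u) ^ 2 := by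
    have := b.sum_inner_mul_inner (WithLp.toLp 2 u) (WithLp.toLp 2 (C *ᵥ u))
    simp only [EuclideanSpace.inner_eq_star_dotProduct, star_trivial] at this
    rw [dotProduct_comm, ← this]
    refine Finset.sum_congr rfl fun i _ => ?_
    rw [dotProduct_comm (C *ᵥ u), hC.dotProduct_mulVec_comm, hb, dotProduct_smul, smul_eq_mul,
      dotProduct_comm u]
    ring
  rw [hexp]
  refine Finset.sum_nonpos fun i _ => ?_
  -- On a unit eigenvector the hypotheses read `l ≤ l ^ 2` and `l ≤ 1`, so `l ≤ 0` or `l = 1`; in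
  -- the latter case the eigenvector is a multiple of `p`, hence orthogonal to `u`.
  have e1 := h1 (b i).ofLp
  have e2 := h2 (b i).ofLp
  simp only [hb, dotProduct_smul, smul_dotProduct, hbb, smul_eq_mul, mul_one] at e1 e2
  by_cases hl : l i ≤ 0
  · exact mul_nonpos_of_nonpos_of_nonneg hl (sq_nonneg _)
  · have hl1 : l i = 1 := by nlinarith
    obtain ⟨c, hc⟩ := h3 (b i).ofLp (by rw [hb, hl1, one_smul])
    rw [hc, smul_dotProduct, dotProduct_comm, hu]
    simp

/-- Rescale to `C i j = B i j / (s i * s j)` with `s i ^ 2 = (B h) i / h i`. Then `hle` bounds the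
form of `C` by that of `C ^ 2`, and the Laplacian identity bounds it by the identity. The star
around `i₀` makes the graph connected apart from zero rows, so the eigenvalue 1 lives only on the
line of `s * h`. Orthogonality to that line is orthogonality to `B h` in the original coordinates.
-/
theorem Matrix.isLorentzian_of_le_sum_sq {B : Matrix ι ι ℝ} (hB : B.IsSymm)
    (hnn : ∀ i j, 0 ≤ B i j) {h : ι → ℝ} (hpos : ∀ i, 0 < h i)
    (hle : ∀ v, v ⬝ᵥ B *ᵥ v ≤ ∑ i, h i * (B *ᵥ v) i ^ 2 / (B *ᵥ h) i) (i₀ : ι)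
    (hconn : ∀ i, i = i₀ ∨ 0 < B i i₀ ∨ ∀ j, B i j = 0) : B.IsLorentzian := by
  classical
  refine isLorentzian_of_nonpos_orthogonal h fun v hv => ?_
  have hd : ∀ i, 0 ≤ (B *ᵥ h) i := mulVec_nonneg hnn hpos
  set s : ι → ℝ := fun i => √((B *ᵥ h) i / h i) with hs
  have hs2 : ∀ i, s i ^ 2 = (B *ᵥ h) i / h i := fun i =>
    Real.sq_sqrt (div_nonneg (hd i) (hpos i).le)
  -- Where `s i = 0` the whole row vanishes, so the convention `a / 0 = 0` does no harm.
  have hs0 : ∀ i, s i = 0 → ∀ j, B i j = 0 := by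
    intro i hi j
    have := hs2 i
    rw [hi, zero_pow two_ne_zero, eq_comm, div_eq_zero_iff] at this
    exact apply_eq_zero_of_mulVec_eq_zero hnn hpos (this.resolve_right (hpos i).ne') j
  have hs0' : ∀ i, s i = 0 → ∀ j, B j i = 0 := fun i hi j => by rw [hB.apply]; exact hs0 i hi j
  set C : Matrix ι ι ℝ := of fun i j => B i j / (s i * s j) with hCdef
  have hC : C.IsSymm := by
    ext i j; simp only [hCdef, transpose_apply, of_apply, hB.apply i j, mul_comm]
  have hCm : ∀ u i, (C *ᵥ u) i = (B *ᵥ (fun j => u j / s j)) i / s i := by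
    intro u i
    simp only [mulVec, dotProduct, hCdef, of_apply, Finset.sum_div]
    refine Finset.sum_congr rfl fun j _ => ?_
    simp only [div_eq_mul_inv, mul_inv]; ring
  have hCq : ∀ u, u ⬝ᵥ C *ᵥ u = (fun j => u j / s j) ⬝ᵥ B *ᵥ (fun j => u j / s j) := by
    intro u
    simp only [dotProduct, hCm]
    refine Finset.sum_congr rfl fun j _ => ?_
    simp only [div_eq_mul_inv]; ring
  have hle' : ∀ u : ι → ℝ, ∑ i, (B *ᵥ h) i / h i * (u i / s i) ^ 2 ≤ u ⬝ᵥ u := by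
    intro u
    refine Finset.sum_le_sum fun i _ => ?_
    rw [← hs2]
    by_cases h0 : s i = 0
    · simp [h0, mul_self_nonneg]
    · apply le_of_eq; field_simp
  have hlap := fun u : ι → ℝ => laplacian_identity hB hpos (fun j => u j / s j)
  have hterm : ∀ (u : ι → ℝ) i j, 0 ≤ B i j * h i * h j * (u i / s i / h i - u j / s j / h j) ^ 2 :=
    fun u i j => mul_nonneg (mul_nonneg (mul_nonneg (hnn i j) (hpos i).le) (hpos j).le)
      (sq_nonneg _)
  have hfin := nonpos_of_eigen hC (fun i => s i * h i) ?_ ?_ ?_ (fun i => s i * v i) ?_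
  · rw [hCq] at hfin
    refine le_trans (le_of_eq ?_) hfin
    simp only [dotProduct, mulVec, Finset.mul_sum]
    refine Finset.sum_congr rfl fun i _ => Finset.sum_congr rfl fun j _ => ?_
    by_cases hi : s i = 0
    · simp [hs0 i hi]
    by_cases hj : s j = 0
    · simp [hs0' j hj]
    rw [mul_div_cancel_left₀ _ hi, mul_div_cancel_left₀ _ hj]
  · intro u
    rw [hCq]
    refine (hle _).trans (le_of_eq ?_)
    refine Finset.sum_congr rfl fun i _ => ?_
    rw [hCm, div_mul_div_comm, ← sq, ← sq, hs2, mul_comm, div_div_eq_mul_div]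
  · intro u
    rw [hCq]
    have : 0 ≤ ∑ i, ∑ j, B i j * h i * h j * (u i / s i / h i - u j / s j / h j) ^ 2 :=
      Finset.sum_nonneg fun i _ => Finset.sum_nonneg fun j _ => hterm u i j
    linarith [hlap u, hle' u]
  · intro u hu
    have h0 : ∑ i, ∑ j, B i j * h i * h j * (u i / s i / h i - u j / s j / h j) ^ 2 = 0 := by
      apply le_antisymm
      · have := hCq u
        rw [hu] at this
        linarith [hlap u, hle' u]
      · exact Finset.sum_nonneg fun i _ => Finset.sum_nonneg fun j _ => hterm u i j
    have hzero : ∀ i j, B i j * h i * h j * (u i / s i / h i - u j / s j / h j) ^ 2 = 0 := by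
      intro i j
      have := (Finset.sum_eq_zero_iff_of_nonneg
        (fun i _ => Finset.sum_nonneg fun j _ => hterm u i j)).1 h0 i (Finset.mem_univ i)
      exact (Finset.sum_eq_zero_iff_of_nonneg (fun j _ => hterm u i j)).1 this j
        (Finset.mem_univ j)
    refine ⟨u i₀ / s i₀ / h i₀, ?_⟩
    ext i
    simp only [Pi.smul_apply, smul_eq_mul]
    by_cases hi : s i = 0
    · have := congrFun hu i
      rw [hCm, hi, div_zero] at this
      rw [← this, hi]; simp
    have key : u i / s i / h i = u i₀ / s i₀ / h i₀ := by
      rcases hconn i with rfl | hB0 | hB0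
      · rfl
      · have := hzero i i₀
        have hne : B i i₀ * h i * h i₀ ≠ 0 :=
          (mul_pos (mul_pos hB0 (hpos i)) (hpos i₀)).ne'
        have := (mul_eq_zero.1 this).resolve_left hne
        exact sub_eq_zero.1 (pow_eq_zero_iff two_ne_zero |>.1 this)
      · exfalso
        apply hi
        have : (B *ᵥ h) i = 0 := by simp [mulVec, dotProduct, hB0]
        simp [hs, this]
    rw [← key]
    have := (hpos i).ne'
    field_simp
  · rw [← hv]
    simp only [dotProduct]
    refine Finset.sum_congr rfl fun i _ => ?_
    have := (hpos i).ne'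
    have h2 := hs2 i
    rw [eq_div_iff this] at h2
    rw [← h2]; ring

/-- The Lorentzian property passes from the matrices `A i` to a matrix `B` whose rows are inherited
from them. -/
theorem Matrix.isLorentzian_of_inheritance {B : Matrix ι ι ℝ} (hB : B.IsSymm)
    (hnn : ∀ i j, 0 ≤ B i j) {h : ι → ℝ} (hpos : ∀ i, 0 < h i) (A : ι → Matrix ι ι ℝ)
    (hA : ∀ i, (A i).IsSymm) (hAnn : ∀ i j k, 0 ≤ A i j k) (hyp : ∀ i, (A i).IsLorentzian)
    (T : ι → (ι → ℝ) → (ι → ℝ)) (hT : ∀ i, T i h = h)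
    (inh : ∀ v i, (B *ᵥ v) i = T i v ⬝ᵥ A i *ᵥ h)
    (pull : ∀ v, v ⬝ᵥ B *ᵥ v ≤ ∑ i, h i * (T i v ⬝ᵥ A i *ᵥ T i v)) (i₀ : ι)
    (hconn : ∀ i, i = i₀ ∨ 0 < B i i₀ ∨ ∀ j, B i j = 0) : B.IsLorentzian := by
  refine isLorentzian_of_le_sum_sq hB hnn hpos (fun v => (pull v).trans ?_) i₀ hconn
  refine Finset.sum_le_sum fun i _ => ?_
  rw [mul_div_assoc]
  refine mul_le_mul_of_nonneg_left ?_ (hpos i).le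
  have hh : (B *ᵥ h) i = h ⬝ᵥ A i *ᵥ h := by rw [inh, hT]
  have h0 : 0 ≤ h ⬝ᵥ A i *ᵥ h := hh ▸ mulVec_nonneg hnn hpos i
  -- Since `h > 0` and `A i ≥ 0`, a zero value of the form at `h` forces `A i = 0`; otherwise
  -- reversed Cauchy-Schwarz for `A i`, applied to `T i v` and `h`, gives the bound.
  rcases h0.eq_or_lt with h1 | h1
  · have hz : ∀ j k, A i j k = 0 := by
      intro j k
      have := (Finset.sum_eq_zero_iff_of_nonneg (fun j _ =>
        mul_nonneg (hpos j).le (mulVec_nonneg (hAnn i) hpos j))).1 h1.symm j (Finset.mem_univ j)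
      exact apply_eq_zero_of_mulVec_eq_zero (hAnn i) hpos
        ((mul_eq_zero.1 this).resolve_left (hpos j).ne') k
    have : A i = 0 := by ext j k; exact hz j k
    simp [hh, this]
  · rw [le_div_iff₀ (hh ▸ h1), inh v, hh]
    exact (hyp i).mul_le_sq (hA i) _ _ h1.le

end Lorentzian

/-! ### Words of available letters and the pullback inequality. -/

section Words

open Matrix

variable {X : Type*} [PartialOrder X] [Fintype X]

open Classical in
/-- The elements of `L` outside `I` all of whose predecessors lie in `I`. -/
noncomputable def avail (L : Set X) (I : Finset X) : Finset X :=
  Finset.univ.filter fun y => y ∈ L ∧ y ∉ I ∧ ∀ w < y, w ∈ I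

theorem mem_avail {L : Set X} {I : Finset X} {y : X} :
    y ∈ avail L I ↔ y ∈ L ∧ y ∉ I ∧ ∀ w < y, w ∈ I := by
  simp [avail]

theorem notMem_of_mem_avail {L : Set X} {I : Finset X} {y : X} (hy : y ∈ avail L I) : y ∉ I :=
  (mem_avail.1 hy).2.1

theorem mem_avail_iff_univ {L : Set X} {I : Finset X} {y : X} :
    y ∈ avail L I ↔ y ∈ avail Set.univ I ∧ y ∈ L := by
  simp only [mem_avail, Set.mem_univ, true_and]; tauto

theorem avail_subset_univ (L : Set X) (I : Finset X) : avail L I ⊆ avail Set.univ I :=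
  fun _ hy => (mem_avail_iff_univ.1 hy).1

theorem avail_mono {L : Set X} {I J : Finset X} (hIJ : I ⊆ J) {y : X} (hy : y ∈ avail L I)
    (hJ : y ∉ J) : y ∈ avail L J := by
  rw [mem_avail] at hy ⊢
  exact ⟨hy.1, hJ, fun w hw => hIJ (hy.2.2 w hw)⟩

open Classical in
/-- The vector on the letters seen after `x` has been added to `I`: a letter which only becomes
available by this addition inherits the value at `x`. -/
noncomputable def shift (L : Set X) (I : Finset X) (x : X) (v : X → ℝ) : X → ℝ :=
  fun y => if y ∈ avail L I then v y else v x

theorem shift_of_mem {L : Set X} {I : Finset X} {x y : X} {v : X → ℝ} (hy : y ∈ avail L I) :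
    shift L I x v y = v y := if_pos hy

theorem shift_of_notMem {L : Set X} {I : Finset X} {x y : X} {v : X → ℝ} (hy : y ∉ avail L I) :
    shift L I x v y = v x := if_neg hy

theorem shift_const (L : Set X) (I : Finset X) (x : X) (c : ℝ) :
    shift L I x (fun _ => c) = fun _ => c := by
  ext y; simp [shift]

variable [DecidableEq X]

theorem mem_avail_insert {L : Set X} {I : Finset X} {x y : X} (hy : y ∈ avail L I) (hxy : y ≠ x) :
    y ∈ avail L (insert x I) := by
  refine avail_mono (Finset.subset_insert x I) hy ?_
  rw [Finset.mem_insert, not_or]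
  exact ⟨hxy, (mem_avail.1 hy).2.1⟩

theorem ne_of_mem_avail_insert {L : Set X} {I : Finset X} {x y : X}
    (hy : y ∈ avail L (insert x I)) : y ≠ x := by
  rintro rfl
  exact (mem_avail.1 hy).2.1 (Finset.mem_insert_self _ _)

theorem mem_avail_of_mem_insert_insert {L : Set X} {I : Finset X} {x y z : X} (hxy : x ≠ y)
    (hx : z ∈ avail L (insert x I)) (hy : z ∈ avail L (insert y I)) : z ∈ avail L I := by
  rw [mem_avail] at hx hy ⊢
  refine ⟨hx.1, fun h => hx.2.1 (Finset.mem_insert_of_mem h), fun w hw => ?_⟩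
  have h1 := Finset.mem_insert.1 (hx.2.2 w hw)
  have h2 := Finset.mem_insert.1 (hy.2.2 w hw)
  rcases h1 with rfl | h1
  · exact h2.resolve_left hxy
  · exact h1

/-- The quadratic form counting two-letter continuations of `I` with weight `W`. -/
noncomputable def letterForm (L : Set X) (W : Finset X → ℝ) (I : Finset X) (v : X → ℝ) : ℝ :=
  ∑ x ∈ avail L I, ∑ y ∈ avail L (insert x I), v x * shift L I x v y * W (insert y (insert x I))

/-- Words `x y z` are sorted by which letters become available late. The four surviving types are:
all available at `I`; `z` released by `y` alone; `z` released only by `x` and `y` together; `y`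
released by `x` with `z` available at `I`. In all other cases `z` inherits the value `v x` and the
factor vanishes. -/
theorem shift_shift_cases {L : Set X} {I : Finset X} {x y z : X} (v : X → ℝ)
    (hx : x ∈ avail L I) (hy : y ∈ avail L (insert x I))
    (hz : z ∈ avail L (insert y (insert x I))) (w : ℝ) :
    shift L I x v y * (shift L (insert x I) y (shift L I x v) z - v x) * w =
      (if x ∈ avail L I ∧ y ∈ avail L I ∧ z ∈ avail L I ∧ x ≠ y ∧ y ≠ z ∧ x ≠ z then
        v y * (v z - v x) * w else 0) +
      (if x ∈ avail L I ∧ y ∈ avail L I ∧ x ≠ y ∧ z ∉ avail L I ∧ z ∈ avail L (insert y I) then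
        v y * (v y - v x) * w else 0) +
      (if x ∈ avail L I ∧ y ∈ avail L I ∧ x ≠ y ∧ z ∉ avail L (insert x I) ∧
          z ∉ avail L (insert y I) ∧ z ∈ avail L (insert y (insert x I)) then
        v y * (v y - v x) * w else 0) +
      (if z ∈ avail L I ∧ x ∈ avail L I ∧ z ≠ x ∧ y ∉ avail L I ∧ y ∈ avail L (insert x I) then
        v x * (v z - v x) * w else 0) := by
  have h1 := ne_of_mem_avail_insert hy
  have h2 := ne_of_mem_avail_insert hz
  have h3 : z ≠ x := by
    rintro rfl
    exact (mem_avail.1 hz).2.1 (Finset.mem_insert_of_mem (Finset.mem_insert_self _ _))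
  have h4 : z ∈ avail L I → z ∈ avail L (insert x I) := fun h => mem_avail_insert h h3
  have h5 : z ∈ avail L I → z ∈ avail L (insert y I) := fun h => mem_avail_insert h h2
  have h6 : z ∈ avail L (insert x I) → z ∈ avail L (insert y I) → z ∈ avail L I :=
    mem_avail_of_mem_insert_insert h1.symm
  by_cases hy0 : y ∈ avail L I <;> by_cases hz0 : z ∈ avail L I <;>
    by_cases hz1 : z ∈ avail L (insert x I) <;> by_cases hz2 : z ∈ avail L (insert y I) <;>
    simp_all [shift, h1.symm, h2.symm, h3.symm]

theorem sum_avail_eq_sum_ite (L : Set X) (I : Finset X) (f : X → X → X → ℝ) :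
    ∑ x ∈ avail L I, ∑ y ∈ avail L (insert x I), ∑ z ∈ avail L (insert y (insert x I)), f x y z =
      ∑ x, ∑ y, ∑ z, if x ∈ avail L I ∧ y ∈ avail L (insert x I) ∧
        z ∈ avail L (insert y (insert x I)) then f x y z else 0 := by
  have h : ∀ (s : Finset X) (g : X → ℝ), ∑ x ∈ s, g x = ∑ x, if x ∈ s then g x else 0 :=
    fun s g => by simp
  rw [h]
  refine Finset.sum_congr rfl fun x _ => ?_
  by_cases hx : x ∈ avail L I
  · rw [if_pos hx, h]
    refine Finset.sum_congr rfl fun y _ => ?_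
    by_cases hy : y ∈ avail L (insert x I)
    · simp only [hx, hy, true_and, if_true]
      exact h _ _
    · simp [hy]
  · simp [hx]

/-- In the difference of the two sides the first type is antisymmetric in `x` and `z`, and the
second and fourth cancel after a cyclic relabelling. The third, symmetrised in `x` and `y`, leaves
`(v x - v y) ^ 2` times a nonnegative weight. -/
theorem letterForm_le_sum (L : Set X) {W W' : Finset X → ℝ} (hW' : ∀ J, 0 ≤ W' J) (I : Finset X)
    (hW : ∀ x ∈ avail L I, ∀ y ∈ avail L (insert x I), W (insert y (insert x I)) =
      ∑ z ∈ avail L (insert y (insert x I)), W' (insert z (insert y (insert x I)))) (v : X → ℝ) :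
    letterForm L W I v ≤ ∑ x ∈ avail L I, letterForm L W' (insert x I) (shift L I x v) := by
  rw [← sub_nonneg]
  have h1 : ∑ x ∈ avail L I, letterForm L W' (insert x I) (shift L I x v) - letterForm L W I v =
      ∑ x ∈ avail L I, ∑ y ∈ avail L (insert x I), ∑ z ∈ avail L (insert y (insert x I)),
        shift L I x v y * (shift L (insert x I) y (shift L I x v) z - v x) *
          W' (insert z (insert y (insert x I))) := by
    rw [letterForm, ← Finset.sum_sub_distrib]
    refine Finset.sum_congr rfl fun x hx => ?_
    rw [letterForm, ← Finset.sum_sub_distrib]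
    refine Finset.sum_congr rfl fun y hy => ?_
    rw [hW x hx y hy, Finset.mul_sum, ← Finset.sum_sub_distrib]
    exact Finset.sum_congr rfl fun z _ => by ring
  have h2 : ∀ x y z, (if x ∈ avail L I ∧ y ∈ avail L (insert x I) ∧
        z ∈ avail L (insert y (insert x I)) then
        shift L I x v y * (shift L (insert x I) y (shift L I x v) z - v x) *
          W' (insert z (insert y (insert x I))) else 0) =
      (if x ∈ avail L I ∧ y ∈ avail L I ∧ z ∈ avail L I ∧ x ≠ y ∧ y ≠ z ∧ x ≠ z then
        v y * (v z - v x) * W' (insert z (insert y (insert x I))) else 0) +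
      (if x ∈ avail L I ∧ y ∈ avail L I ∧ x ≠ y ∧ z ∉ avail L I ∧ z ∈ avail L (insert y I) then
        v y * (v y - v x) * W' (insert z (insert y (insert x I))) else 0) +
      (if x ∈ avail L I ∧ y ∈ avail L I ∧ x ≠ y ∧ z ∉ avail L (insert x I) ∧
          z ∉ avail L (insert y I) ∧ z ∈ avail L (insert y (insert x I)) then
        v y * (v y - v x) * W' (insert z (insert y (insert x I))) else 0) +
      (if z ∈ avail L I ∧ x ∈ avail L I ∧ z ≠ x ∧ y ∉ avail L I ∧ y ∈ avail L (insert x I) then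
        v x * (v z - v x) * W' (insert z (insert y (insert x I))) else 0) := by
    intro x y z
    by_cases h : x ∈ avail L I ∧ y ∈ avail L (insert x I) ∧ z ∈ avail L (insert y (insert x I))
    · rw [if_pos h, shift_shift_cases v h.1 h.2.1 h.2.2]
    · rw [if_neg h, if_neg, if_neg, if_neg, if_neg]
      · simp
      · rintro ⟨hz, hx, hzx, hy, hy'⟩
        refine h ⟨hx, hy', mem_avail_insert (mem_avail_insert hz hzx) ?_⟩
        rintro rfl; exact hy hz
      · rintro ⟨hx, hy, hxy, -, -, hz⟩
        exact h ⟨hx, mem_avail_insert hy hxy.symm, hz⟩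
      · rintro ⟨hx, hy, hxy, hz, hz'⟩
        refine h ⟨hx, mem_avail_insert hy hxy.symm, ?_⟩
        rw [Finset.insert_comm]
        refine mem_avail_insert hz' ?_
        rintro rfl; exact hz hx
      · rintro ⟨hx, hy, hz, hxy, hyz, hxz⟩
        exact h ⟨hx, mem_avail_insert hy hxy.symm,
          mem_avail_insert (mem_avail_insert hz hxz.symm) hyz.symm⟩
  rw [h1, sum_avail_eq_sum_ite]
  simp only [h2, Finset.sum_add_distrib]
  have s1 : ∑ x, ∑ y, ∑ z,
      (if x ∈ avail L I ∧ y ∈ avail L I ∧ z ∈ avail L I ∧ x ≠ y ∧ y ≠ z ∧ x ≠ z then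
        v y * (v z - v x) * W' (insert z (insert y (insert x I))) else 0) = 0 := by
    set f : X → X → X → ℝ := fun x y z =>
      (if x ∈ avail L I ∧ y ∈ avail L I ∧ z ∈ avail L I ∧ x ≠ y ∧ y ≠ z ∧ x ≠ z then
        v y * (v z - v x) * W' (insert z (insert y (insert x I))) else 0) with hf
    have e1 : ∑ x, ∑ y, ∑ z, f x y z = ∑ x, ∑ y, ∑ z, f z y x := by
      rw [Finset.sum_comm]
      conv_rhs => rw [Finset.sum_comm]
      exact Finset.sum_congr rfl fun y _ => Finset.sum_comm
    have e2 : ∀ x y z, f z y x = - f x y z := by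
      intro x y z
      simp only [hf]
      have : insert x (insert y (insert z I)) = insert z (insert y (insert x I)) := by
        ext; simp only [Finset.mem_insert]; tauto
      rw [this]
      by_cases hc : x ∈ avail L I ∧ y ∈ avail L I ∧ z ∈ avail L I ∧ x ≠ y ∧ y ≠ z ∧ x ≠ z
      · rw [if_pos hc, if_pos ⟨hc.2.2.1, hc.2.1, hc.1, hc.2.2.2.2.1.symm, hc.2.2.2.1.symm,
          hc.2.2.2.2.2.symm⟩]
        ring
      · rw [if_neg hc, if_neg, neg_zero]
        rintro ⟨a, b, c, d, e, f⟩
        exact hc ⟨c, b, a, e.symm, d.symm, f.symm⟩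
    have e3 : ∑ x, ∑ y, ∑ z, f z y x = - ∑ x, ∑ y, ∑ z, f x y z := by
      simp only [← Finset.sum_neg_distrib]
      exact Finset.sum_congr rfl fun x _ => Finset.sum_congr rfl fun y _ =>
        Finset.sum_congr rfl fun z _ => e2 x y z
    linarith
  have s2 : ∑ x, ∑ y, ∑ z,
      (if z ∈ avail L I ∧ x ∈ avail L I ∧ z ≠ x ∧ y ∉ avail L I ∧ y ∈ avail L (insert x I) then
        v x * (v z - v x) * W' (insert z (insert y (insert x I))) else 0) =
      - ∑ x, ∑ y, ∑ z,
      (if x ∈ avail L I ∧ y ∈ avail L I ∧ x ≠ y ∧ z ∉ avail L I ∧ z ∈ avail L (insert y I) then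
        v y * (v y - v x) * W' (insert z (insert y (insert x I))) else 0) := by
    conv_rhs => rw [Finset.sum_comm]
    simp only [← Finset.sum_neg_distrib]
    refine Finset.sum_congr rfl fun x _ => ?_
    rw [Finset.sum_comm]
    refine Finset.sum_congr rfl fun z _ => Finset.sum_congr rfl fun y _ => ?_
    have : insert y (insert x (insert z I)) = insert z (insert y (insert x I)) := by
      ext; simp only [Finset.mem_insert]; tauto
    rw [this]
    split_ifs
    · ring
    · simp
  have s3 : 0 ≤ ∑ x, ∑ y, ∑ z,
      (if x ∈ avail L I ∧ y ∈ avail L I ∧ x ≠ y ∧ z ∉ avail L (insert x I) ∧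
          z ∉ avail L (insert y I) ∧ z ∈ avail L (insert y (insert x I)) then
        v y * (v y - v x) * W' (insert z (insert y (insert x I))) else 0) := by
    set f : X → X → X → ℝ := fun x y z =>
      (if x ∈ avail L I ∧ y ∈ avail L I ∧ x ≠ y ∧ z ∉ avail L (insert x I) ∧
          z ∉ avail L (insert y I) ∧ z ∈ avail L (insert y (insert x I)) then
        v y * (v y - v x) * W' (insert z (insert y (insert x I))) else 0) with hf
    have e1 : ∑ x, ∑ y, ∑ z, f x y z = ∑ x, ∑ y, ∑ z, f y x z := Finset.sum_comm
    have e2 : ∀ x y z, 0 ≤ f x y z + f y x z := by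
      intro x y z
      simp only [hf]
      rw [Finset.insert_comm x y I]
      by_cases hc : x ∈ avail L I ∧ y ∈ avail L I ∧ x ≠ y ∧ z ∉ avail L (insert x I) ∧
          z ∉ avail L (insert y I) ∧ z ∈ avail L (insert y (insert x I))
      · rw [if_pos hc, if_pos ⟨hc.2.1, hc.1, hc.2.2.1.symm, hc.2.2.2.2.1, hc.2.2.2.1,
          hc.2.2.2.2.2⟩]
        nlinarith [mul_nonneg (sq_nonneg (v x - v y)) (hW' (insert z (insert y (insert x I))))]
      · rw [if_neg hc, if_neg, add_zero]
        rintro ⟨a, b, c, d, e, f⟩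
        exact hc ⟨b, a, c.symm, e, d, f⟩
    have e3 : 0 ≤ ∑ x, ∑ y, ∑ z, (f x y z + f y x z) :=
      Finset.sum_nonneg fun x _ => Finset.sum_nonneg fun y _ => Finset.sum_nonneg fun z _ =>
        e2 x y z
    simp only [Finset.sum_add_distrib] at e3
    linarith
  rw [s1, s2]
  linarith

end Words

/-! ### Matrices of the letter forms, plain and bordered. -/

section FormMatrices

open Matrix

variable {X : Type*} [PartialOrder X] [Fintype X] [DecidableEq X]

/-- The symmetric matrix of `letterForm`. -/
noncomputable def letterMatrix (L : Set X) (W : Finset X → ℝ) (I : Finset X) : Matrix X X ℝ :=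
  of fun x y => if x ∈ avail L I then ∑ z ∈ avail L (insert x I),
    shift L I x (Pi.single y 1) z * W (insert z (insert x I)) else 0

theorem letterMatrix_mulVec (L : Set X) (W : Finset X → ℝ) (I : Finset X) (v : X → ℝ) (x : X) :
    (letterMatrix L W I *ᵥ v) x = if x ∈ avail L I then ∑ z ∈ avail L (insert x I),
      shift L I x v z * W (insert z (insert x I)) else 0 := by
  simp only [letterMatrix, mulVec, dotProduct, of_apply]
  split_ifs with hx
  · simp only [Finset.sum_mul]
    rw [Finset.sum_comm]
    refine Finset.sum_congr rfl fun z _ => ?_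
    by_cases hz : z ∈ avail L I
    · simp only [shift_of_mem hz]
      rw [Finset.sum_eq_single z] <;> simp +contextual [eq_comm, mul_comm]
    · simp only [shift_of_notMem hz]
      rw [Finset.sum_eq_single x] <;> simp +contextual [eq_comm, mul_comm]
  · simp

theorem dotProduct_letterMatrix_mulVec (L : Set X) (W : Finset X → ℝ) (I : Finset X)
    (u v : X → ℝ) : u ⬝ᵥ letterMatrix L W I *ᵥ v = ∑ x ∈ avail L I,
      ∑ y ∈ avail L (insert x I), u x * shift L I x v y * W (insert y (insert x I)) := by
  simp only [dotProduct, letterMatrix_mulVec, mul_ite, mul_zero, Finset.sum_ite_mem,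
    Finset.univ_inter, Finset.mul_sum, mul_assoc]

theorem letterForm_eq (L : Set X) (W : Finset X → ℝ) (I : Finset X) (v : X → ℝ) :
    letterForm L W I v = v ⬝ᵥ letterMatrix L W I *ᵥ v :=
  (dotProduct_letterMatrix_mulVec L W I v v).symm

theorem letterMatrix_apply_of_ne (L : Set X) (W : Finset X → ℝ) (I : Finset X) {x y : X}
    (hxy : x ≠ y) : letterMatrix L W I x y =
      if x ∈ avail L I ∧ y ∈ avail L I then W (insert y (insert x I)) else 0 := by
  rw [letterMatrix, of_apply, ite_and]
  refine if_congr Iff.rfl ?_ rfl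
  have h : ∀ z ∈ avail L (insert x I), shift L I x (Pi.single y 1) z * W (insert z (insert x I)) =
      if z = y then (if y ∈ avail L I then W (insert y (insert x I)) else 0) else 0 := by
    intro z _
    by_cases hz : z ∈ avail L I
    · rw [shift_of_mem hz]
      by_cases hzy : z = y
      · subst hzy; simp [hz]
      · simp [hzy]
    · rw [shift_of_notMem hz, Pi.single_eq_of_ne hxy]
      by_cases hzy : z = y
      · subst hzy; simp [hz]
      · simp [hzy]
  rw [Finset.sum_congr rfl h, Finset.sum_ite_eq']
  by_cases hy : y ∈ avail L I
  · simp [mem_avail_insert hy hxy.symm, hy]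
  · simp [hy]

theorem letterMatrix_isSymm (L : Set X) (W : Finset X → ℝ) (I : Finset X) :
    (letterMatrix L W I).IsSymm := by
  ext x y
  rw [transpose_apply]
  by_cases hxy : x = y
  · rw [hxy]
  · rw [letterMatrix_apply_of_ne _ _ _ hxy, letterMatrix_apply_of_ne _ _ _ (Ne.symm hxy),
      Finset.insert_comm]
    exact if_congr and_comm rfl rfl

theorem letterMatrix_nonneg (L : Set X) {W : Finset X → ℝ} (hW : ∀ J, 0 ≤ W J) (I : Finset X)
    (x y : X) : 0 ≤ letterMatrix L W I x y := by
  rw [letterMatrix, of_apply]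
  split_ifs
  · refine Finset.sum_nonneg fun z _ => mul_nonneg ?_ (hW _)
    have : ∀ a, 0 ≤ (Pi.single y 1 : X → ℝ) a := fun a => by
      rw [Pi.single_apply]; split_ifs <;> norm_num
    rw [shift]; split_ifs <;> exact this _
  · exact le_rfl

theorem letterMatrix_row_eq_zero {L : Set X} {W : Finset X → ℝ} {I : Finset X} {x : X}
    (hx : x ∉ avail L I) (y : X) : letterMatrix L W I x y = 0 := by
  rw [letterMatrix, of_apply, if_neg hx]

/-- The matrix of `letterForm` bordered by a row and a column which count continuations by at
most one letter. -/
noncomputable def borderedMatrix (L : Set X) (W : Finset X → ℝ) (I : Finset X) :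
    Matrix (Option X) (Option X) ℝ :=
  of fun
    | some x, some y => letterMatrix L W I x y
    | some x, none => if x ∈ avail L I then W (insert x I) else 0
    | none, some x => if x ∈ avail L I then W (insert x I) else 0
    | none, none => W I

theorem borderedMatrix_isSymm (L : Set X) (W : Finset X → ℝ) (I : Finset X) :
    (borderedMatrix L W I).IsSymm := by
  ext x y
  rcases x with _ | x <;> rcases y with _ | y <;> try rfl
  exact (letterMatrix_isSymm L W I).apply _ _

theorem borderedMatrix_nonneg (L : Set X) {W : Finset X → ℝ} (hW : ∀ J, 0 ≤ W J) (I : Finset X)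
    (x y : Option X) : 0 ≤ borderedMatrix L W I x y := by
  rcases x with _ | x <;> rcases y with _ | y <;> simp only [borderedMatrix, of_apply]
  · exact hW _
  · split_ifs; exacts [hW _, le_rfl]
  · split_ifs; exacts [hW _, le_rfl]
  · exact letterMatrix_nonneg L hW I x y

theorem borderedMatrix_mulVec_some (L : Set X) (W : Finset X → ℝ) (I : Finset X)
    (v : Option X → ℝ) (x : X) : (borderedMatrix L W I *ᵥ v) (some x) =
      if x ∈ avail L I then ∑ z ∈ avail L (insert x I),
        shift L I x (fun y => v (some y)) z * W (insert z (insert x I)) +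
          v none * W (insert x I) else 0 := by
  have := letterMatrix_mulVec L W I (fun y => v (some y)) x
  rw [mulVec, dotProduct] at this ⊢
  rw [Fintype.sum_option, add_comm]
  simp only [borderedMatrix, of_apply]
  rw [this]
  split_ifs <;> ring

theorem borderedMatrix_mulVec_none (L : Set X) (W : Finset X → ℝ) (I : Finset X)
    (v : Option X → ℝ) : (borderedMatrix L W I *ᵥ v) none =
      ∑ x ∈ avail L I, v (some x) * W (insert x I) + v none * W I := by
  rw [mulVec, dotProduct, Fintype.sum_option]
  simp only [borderedMatrix, of_apply, ite_mul, zero_mul, Finset.sum_ite_mem, Finset.univ_inter]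
  simp only [mul_comm]
  ring

theorem dotProduct_borderedMatrix_mulVec (L : Set X) (W : Finset X → ℝ) (I : Finset X)
    (v : Option X → ℝ) : v ⬝ᵥ borderedMatrix L W I *ᵥ v =
      letterForm L W I (fun y => v (some y)) +
        2 * v none * ∑ x ∈ avail L I, v (some x) * W (insert x I) + v none ^ 2 * W I := by
  rw [dotProduct, Fintype.sum_option, borderedMatrix_mulVec_none]
  simp only [borderedMatrix_mulVec_some, mul_ite, mul_zero, Finset.sum_ite_mem, Finset.univ_inter,
    mul_add, Finset.sum_add_distrib, letterForm, Finset.mul_sum, mul_assoc]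
  have : ∀ x, v (some x) * (v none * W (insert x I)) = v none * (v (some x) * W (insert x I)) :=
    fun x => by ring
  simp only [this, ← Finset.mul_sum]
  ring

theorem borderedMatrix_combination (L : Set X) (W W' : Finset X → ℝ) (I : Finset X) (a b : ℝ) :
    borderedMatrix L (fun J => a * W J + b * W' J) I =
      a • borderedMatrix L W I + b • borderedMatrix L W' I := by
  ext x y
  rcases x with _ | x <;> rcases y with _ | y <;>
    simp only [borderedMatrix, of_apply, letterMatrix, Matrix.add_apply, Matrix.smul_apply,
      smul_eq_mul]
  · split_ifs <;> ring
  · split_ifs <;> ring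
  · split_ifs
    · rw [Finset.mul_sum, Finset.mul_sum, ← Finset.sum_add_distrib]
      exact Finset.sum_congr rfl fun z _ => by ring
    · ring

/-- Let `t → 1` from below in the reversed Cauchy-Schwarz inequality; positivity at `w` persists for
`t` near 1. -/
theorem Matrix.IsLorentzian.of_forall_combination {ι : Type*} [Fintype ι] {A A' : Matrix ι ι ℝ}
    (hA : A.IsSymm) (hA' : A'.IsSymm)
    (h : ∀ t : ℝ, 0 < t → t < 1 → (t • A + (1 - t) • A').IsLorentzian) : A.IsLorentzian := by
  refine isLorentzian_of_mul_le_sq hA fun v w hw => ?_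
  have hdot : ∀ (t : ℝ) (u u' : ι → ℝ), u ⬝ᵥ (t • A + (1 - t) • A') *ᵥ u' =
      t * (u ⬝ᵥ A *ᵥ u') + (1 - t) * (u ⬝ᵥ A' *ᵥ u') := by
    intro t u u'
    simp only [add_mulVec, smul_mulVec, dotProduct_add, dotProduct_smul, smul_eq_mul]
  have hlim : ∀ p q : ℝ, Filter.Tendsto (fun t : ℝ => t * p + (1 - t) * q)
      (nhdsWithin 1 (Set.Iio 1)) (nhds p) := by
    intro p q
    have : Continuous fun t : ℝ => t * p + (1 - t) * q := by fun_prop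
    have h2 := this.tendsto 1
    simp only [one_mul, sub_self, zero_mul, add_zero] at h2
    exact h2.mono_left nhdsWithin_le_nhds
  refine le_of_tendsto_of_tendsto
    ((hlim _ (v ⬝ᵥ A' *ᵥ v)).mul (hlim _ (w ⬝ᵥ A' *ᵥ w)))
    ((hlim _ (v ⬝ᵥ A' *ᵥ w)).pow 2) ?_
  have h1 : ∀ᶠ t : ℝ in nhdsWithin 1 (Set.Iio 1), t ∈ Set.Ioo (0 : ℝ) 1 :=
    Ioo_mem_nhdsLT zero_lt_one
  filter_upwards [h1, (hlim _ (w ⬝ᵥ A' *ᵥ w)).eventually_const_lt hw] with t ht htw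
  have := (h t ht.1 ht.2).mul_le_sq ((hA.smul t).add (hA'.smul (1 - t))) v w
  simp only [hdot] at this
  exact this htw.le

theorem Matrix.IsLorentzian.of_le {ι κ : Type*} [Fintype ι] [Fintype κ] {A : Matrix ι ι ℝ}
    (hA : A.IsLorentzian) {B : Matrix κ κ ℝ} (φ : (κ → ℝ) → (ι → ℝ))
    (hφ : ∀ v w (s : ℝ), φ (v - s • w) = φ v - s • φ w)
    (hle : ∀ v, v ⬝ᵥ B *ᵥ v ≤ φ v ⬝ᵥ A *ᵥ φ v) : B.IsLorentzian := by
  intro v w hw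
  obtain ⟨s, hs⟩ := hA (φ v) (φ w) (hw.trans_le (hle w))
  exact ⟨s, (hle _).trans (by rwa [hφ])⟩

theorem Matrix.isLorentzian_zero {ι : Type*} [Fintype ι] :
    (0 : Matrix ι ι ℝ).IsLorentzian := fun v w h => by simp at h

/-- One level of the induction for bordered matrices. -/
theorem borderedMatrix_isLorentzian_step (L : Set X) {W W' : Finset X → ℝ}
    (hW' : ∀ J, 0 ≤ W' J) (hW : ∀ J, W J = ∑ z ∈ avail L J, W' (insert z J))
    (her : ∀ J, W' J = 0 → ∀ z ∈ avail L J, W' (insert z J) = 0) (I : Finset X)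
    (h0 : (borderedMatrix L W' I).IsLorentzian)
    (h1 : ∀ x ∈ avail L I, (borderedMatrix L W' (insert x I)).IsLorentzian) :
    (borderedMatrix L W I).IsLorentzian := by
  refine .of_forall_combination (borderedMatrix_isSymm L W I) (borderedMatrix_isSymm L W' I)
    fun t ht0 ht1 => ?_
  have ht1' : 0 < 1 - t := sub_pos.2 ht1
  have hW0 : ∀ J, 0 ≤ W J := fun J => by rw [hW]; exact Finset.sum_nonneg fun z _ => hW' _
  set V : Finset X → ℝ := fun J => t * W J + (1 - t) * W' J with hV
  have hV0 : ∀ J, 0 ≤ V J := fun J => by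
    have := hW0 J; have := hW' J; simp only [hV]; positivity
  -- The weight `W` alone would call for `h` equal to 1 on letters and 0 on the border, which is not
  -- strictly positive. Mixing in `W'` makes `h` positive, and `borderedMatrix L W' J` applied to
  -- `h` produces exactly the mixed weight `V`.
  set h : Option X → ℝ := fun o => o.elim (1 - t) (fun _ => t) with hh
  have hmul : ∀ (J : Finset X) (u : Option X → ℝ), u ⬝ᵥ borderedMatrix L W' J *ᵥ h =
      ∑ y ∈ avail L J, u (some y) * V (insert y J) + u none * V J := by
    intro J u
    rw [dotProduct, Fintype.sum_option, borderedMatrix_mulVec_none]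
    simp only [borderedMatrix_mulVec_some, mul_ite, mul_zero, Finset.sum_ite_mem,
      Finset.univ_inter, hh, Option.elim, shift_const, ← Finset.mul_sum, ← hW]
    rw [add_comm]
  rw [← borderedMatrix_combination]
  change (borderedMatrix L V I).IsLorentzian
  refine isLorentzian_of_inheritance (borderedMatrix_isSymm L V I)
    (borderedMatrix_nonneg L hV0 I) (h := h) ?_
    (fun o => o.elim (borderedMatrix L W' I)
      (fun x => if x ∈ avail L I then borderedMatrix L W' (insert x I) else 0)) ?_ ?_ ?_
    (fun o v => o.elim v
      (fun x o' => o'.elim (v none) (shift L I x fun y => v (some y)))) ?_ ?_ ?_ none ?_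
  · rintro (_ | x); exacts [ht1', ht0]
  · rintro (_ | x)
    · exact borderedMatrix_isSymm ..
    · simp only [Option.elim]; split_ifs
      · exact borderedMatrix_isSymm ..
      · exact isSymm_zero
  · rintro (_ | x) i j
    · exact borderedMatrix_nonneg L hW' I i j
    · simp only [Option.elim]; split_ifs
      · exact borderedMatrix_nonneg L hW' _ i j
      · exact le_rfl
  · rintro (_ | x)
    · exact h0
    · simp only [Option.elim]; split_ifs with hx
      · exact h1 x hx
      · exact isLorentzian_zero
  · rintro (_ | x)
    · rfl
    · ext o
      rcases o with _ | y
      · rfl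
      · simp only [Option.elim, hh, shift_const]
  · rintro v (_ | x)
    · simp only [Option.elim]
      rw [hmul, borderedMatrix_mulVec_none]
    · simp only [Option.elim]
      rw [borderedMatrix_mulVec_some]
      split_ifs
      · rw [hmul]
      · simp
  · intro v
    rw [hV, borderedMatrix_combination, add_mulVec, smul_mulVec, smul_mulVec, dotProduct_add,
      dotProduct_smul, dotProduct_smul, Fintype.sum_option, add_comm]
    simp only [Option.elim, smul_eq_mul, hh]
    refine add_le_add le_rfl ?_
    rw [← Finset.mul_sum]
    refine mul_le_mul_of_nonneg_left ?_ ht0.le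
    set T : X → Option X → ℝ := fun x o' => o'.elim (v none) (shift L I x fun y => v (some y))
      with hT
    have hsum : ∑ x, T x ⬝ᵥ (if x ∈ avail L I then borderedMatrix L W' (insert x I) else 0) *ᵥ T x
        = ∑ x ∈ avail L I, T x ⬝ᵥ borderedMatrix L W' (insert x I) *ᵥ T x := by
      have (x : X) : T x ⬝ᵥ
          (if x ∈ avail L I then borderedMatrix L W' (insert x I) else 0) *ᵥ T x =
            if x ∈ avail L I then T x ⬝ᵥ borderedMatrix L W' (insert x I) *ᵥ T x else 0 := by
        split_ifs <;> simp
      simp only [this, Finset.sum_ite_mem, Finset.univ_inter]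
    refine le_trans ?_ hsum.ge
    simp only [dotProduct_borderedMatrix_mulVec, Finset.sum_add_distrib]
    refine add_le_add (add_le_add ?_ ?_) ?_
    · exact letterForm_le_sum L hW' I (fun x _ y _ => hW _) _
    · simp only [hT, Option.elim]
      rw [← Finset.mul_sum]
      refine le_of_eq (congrArg _ ?_)
      -- The cross terms agree: pairing `v` with the constant vector on either side counts the same
      -- two-letter words.
      have e1 := (letterMatrix_isSymm L W' I).dotProduct_mulVec_comm (fun y => v (some y))
        (fun _ => 1)
      simp only [dotProduct_letterMatrix_mulVec, shift_const] at e1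
      simp only [one_mul, mul_one] at e1
      rw [← e1]
      exact Finset.sum_congr rfl fun x _ => by rw [hW, Finset.mul_sum]
    · simp only [hT, Option.elim]
      rw [← Finset.mul_sum, ← hW]
  · rintro (_ | x)
    · exact .inl rfl
    · refine .inr ?_
      by_cases hx : x ∈ avail L I
      · rcases (hV0 (insert x I)).eq_or_lt with hz | hz
        · refine .inr ?_
          have hz' : W' (insert x I) = 0 := by
            have := mul_nonneg ht0.le (hW0 (insert x I))
            have h3 := hW' (insert x I)
            simp only [hV] at hz
            nlinarith
          have hz2 : ∀ z ∈ avail L (insert x I), V (insert z (insert x I)) = 0 := by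
            intro z hz0
            have e := her _ hz' z hz0
            simp only [hV, e, hW (insert z (insert x I))]
            rw [Finset.sum_eq_zero fun y hy => her _ e y hy]
            simp
          rintro (_ | y)
          · simp only [borderedMatrix, of_apply, ← hz, ite_self]
          · simp only [borderedMatrix, of_apply, letterMatrix]
            rw [if_pos hx]
            exact Finset.sum_eq_zero fun z hz0 => by rw [hz2 z hz0, mul_zero]
        · left
          simp only [borderedMatrix, of_apply, if_pos hx]
          exact hz
      · right
        rintro (_ | y)
        · simp only [borderedMatrix, of_apply, if_neg hx]
        · exact letterMatrix_row_eq_zero hx y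

end FormMatrices

theorem card_compl_insert {X : Type*} [Fintype X] [DecidableEq X] {I : Finset X} {y : X}
    (hy : y ∉ I) :
    (insert y I)ᶜ.card + 1 = Iᶜ.card := by
  rw [Finset.compl_insert, Finset.card_erase_add_one]
  simpa using hy

/-! ### Lorentzian property for completion counts, and log-concavity. -/

section Completions

open Matrix

variable {X : Type*} [PartialOrder X] [Fintype X] [DecidableEq X]

/-- The total weight `g` of the continuations of `I` by `m` letters in `L`. -/
noncomputable def wordSum (L : Set X) (g : Finset X → ℝ) : ℕ → Finset X → ℝ
  | 0, I => g I
  | m + 1, I => ∑ y ∈ avail L I, wordSum L g m (insert y I)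

/-- The number of ways to complete `I` to a linear extension. -/
noncomputable def completions (I : Finset X) : ℝ :=
  wordSum Set.univ (fun _ => 1) Iᶜ.card I

theorem wordSum_nonneg (L : Set X) {g : Finset X → ℝ} (hg : ∀ J, 0 ≤ g J) (m : ℕ)
    (I : Finset X) : 0 ≤ wordSum L g m I := by
  induction m generalizing I with
  | zero => exact hg I
  | succ m ih => exact Finset.sum_nonneg fun y _ => ih _

theorem completions_nonneg (I : Finset X) : 0 ≤ completions I :=
  wordSum_nonneg _ (fun _ => zero_le_one) _ _

theorem completions_eq_sum {I : Finset X} (hI : Iᶜ.card ≠ 0) :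
    completions I = ∑ y ∈ avail Set.univ I, completions (insert y I) := by
  obtain ⟨n, hn⟩ := Nat.exists_eq_succ_of_ne_zero hI
  rw [completions, hn, wordSum]
  refine Finset.sum_congr rfl fun y hy => ?_
  have := card_compl_insert (notMem_of_mem_avail hy)
  rw [completions, show (insert y I)ᶜ.card = n by omega]

theorem exists_mem_avail {I : Finset X} (hI : Iᶜ.card ≠ 0) : ∃ y, y ∈ avail Set.univ I := by
  obtain ⟨y, hy⟩ := Finset.exists_minimal (Finset.card_ne_zero.1 hI)
  refine ⟨y, mem_avail.2 ⟨trivial, Finset.mem_compl.1 hy.1, fun w hw => ?_⟩⟩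
  by_contra hwI
  exact hy.not_lt (Finset.mem_compl.2 hwI) hw

theorem completions_pos (I : Finset X) : 0 < completions I := by
  induction hn : Iᶜ.card generalizing I with
  | zero => rw [completions, hn, wordSum]; exact one_pos
  | succ n ih =>
    have hI : Iᶜ.card ≠ 0 := by omega
    rw [completions_eq_sum hI]
    refine Finset.sum_pos (fun y hy => ih _ ?_) (exists_mem_avail hI)
    have := card_compl_insert (notMem_of_mem_avail hy)
    omega

theorem letterMatrix_completions_mulVec_one {I : Finset X} (hI : 2 ≤ Iᶜ.card) (u : X → ℝ) :
    u ⬝ᵥ letterMatrix Set.univ completions I *ᵥ (fun _ => 1) =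
      ∑ x ∈ avail Set.univ I, u x * completions (insert x I) := by
  rw [dotProduct_letterMatrix_mulVec]
  refine Finset.sum_congr rfl fun x hx => ?_
  have := card_compl_insert (notMem_of_mem_avail hx)
  rw [completions_eq_sum (by omega), Finset.mul_sum]
  simp only [shift_const, mul_one]

/-- With two letters left, every two-letter word contains the available letter `a` and so carries a
factor `v a`. The form thus vanishes on the hyperplane `v a = 0`, which meets every plane. -/
theorem letterMatrix_completions_isLorentzian_of_card_eq_two {I : Finset X} (hI : Iᶜ.card = 2) :
    (letterMatrix Set.univ completions I).IsLorentzian := by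
  obtain ⟨a, ha⟩ := exists_mem_avail (I := I) (by omega)
  have key : ∀ v : X → ℝ, v a = 0 → v ⬝ᵥ letterMatrix Set.univ completions I *ᵥ v = 0 := by
    intro v hv
    rw [← letterForm_eq]
    refine Finset.sum_eq_zero fun x hx => Finset.sum_eq_zero fun y hy => ?_
    by_cases hxa : x = a
    · rw [hxa, hv]; simp
    · have c1 := card_compl_insert (notMem_of_mem_avail hx)
      have hya : y = a := by
        refine (Finset.card_le_one (s := (insert x I)ᶜ)).1 (by omega) y ?_ a ?_
        · exact Finset.mem_compl.2 (notMem_of_mem_avail hy)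
        · exact Finset.mem_compl.2 (notMem_of_mem_avail (mem_avail_insert ha (Ne.symm hxa)))
      rw [hya, shift_of_mem ha, hv]; simp
  intro v w hw
  have hwa : w a ≠ 0 := fun h => hw.ne' (key w h)
  exact ⟨v a / w a, (key _ (by simp [hwa])).le⟩

theorem letterMatrix_completions_isLorentzian {I : Finset X} (hI : 2 ≤ Iᶜ.card) :
    (letterMatrix Set.univ completions I).IsLorentzian := by
  induction hn : Iᶜ.card using Nat.strong_induction_on generalizing I with
  | _ n ih =>
  rcases hI.eq_or_lt with h2 | h3
  · exact letterMatrix_completions_isLorentzian_of_card_eq_two h2.symm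
  have hc : ∀ x ∈ avail Set.univ I, (insert x I)ᶜ.card + 1 = Iᶜ.card := fun x hx =>
    card_compl_insert (notMem_of_mem_avail hx)
  obtain ⟨i₀, hi₀⟩ := exists_mem_avail (I := I) (by omega)
  refine isLorentzian_of_inheritance (letterMatrix_isSymm _ _ I)
    (letterMatrix_nonneg _ completions_nonneg I) (h := fun _ => 1) (fun _ => one_pos)
    (fun x => if x ∈ avail Set.univ I then letterMatrix Set.univ completions (insert x I) else 0)
    ?_ ?_ ?_ (fun x v => shift Set.univ I x v) (fun x => shift_const _ _ _ _) ?_ ?_ i₀ ?_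
  · intro x; split_ifs
    · exact letterMatrix_isSymm ..
    · exact isSymm_zero
  · intro x i j; split_ifs
    · exact letterMatrix_nonneg _ completions_nonneg _ i j
    · exact le_rfl
  · intro x; split_ifs with hx
    · have := hc x hx
      exact ih _ (by omega) (by omega) rfl
    · exact isLorentzian_zero
  · intro v x
    rw [letterMatrix_mulVec]
    split_ifs with hx
    · have := hc x hx
      rw [letterMatrix_completions_mulVec_one (by omega)]
    · simp
  · intro v
    rw [← letterForm_eq]
    refine (letterForm_le_sum _ completions_nonneg I ?_ v).trans (le_of_eq ?_)
    · intro x hx y hy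
      have := hc x hx
      have := card_compl_insert (notMem_of_mem_avail hy)
      exact completions_eq_sum (by omega)
    · have (x : X) : (1 : ℝ) * (shift Set.univ I x v ⬝ᵥ (if x ∈ avail Set.univ I then
          letterMatrix Set.univ completions (insert x I) else 0) *ᵥ shift Set.univ I x v) =
            if x ∈ avail Set.univ I then
              letterForm Set.univ completions (insert x I) (shift Set.univ I x v) else 0 := by
        split_ifs <;> simp [letterForm_eq]
      simp only [this, Finset.sum_ite_mem, Finset.univ_inter]
  -- Two distinct available letters can be added in either order, so `i₀` has a positive entry with
  -- every other available letter.
  · intro x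
    by_cases hx : x ∈ avail Set.univ I
    · by_cases hx0 : x = i₀
      · exact .inl hx0
      · refine .inr (.inl ?_)
        rw [letterMatrix_apply_of_ne _ _ _ hx0, if_pos ⟨hx, hi₀⟩]
        exact completions_pos _
    · exact .inr (.inr fun y => letterMatrix_row_eq_zero hx y)

/-- The extra words have first letter `x` in `L` and second letter outside `L`. They contribute zero
if the second letter was already available, and `u x ^ 2` times a weight if `x` released it. -/
theorem letterForm_le_letterForm_univ (L : Set X) {W : Finset X → ℝ} (hW : ∀ J, 0 ≤ W J)
    (I : Finset X) (u : X → ℝ) :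
    letterForm L W I u ≤ letterForm Set.univ W I (L.indicator u) := by
  have h0 : letterForm Set.univ W I (L.indicator u) = ∑ x ∈ avail L I,
      ∑ y ∈ avail Set.univ (insert x I), L.indicator u x *
        shift Set.univ I x (L.indicator u) y * W (insert y (insert x I)) := by
    refine (Finset.sum_subset (avail_subset_univ L I) fun x hx hxL => ?_).symm
    have : x ∉ L := fun h => hxL (mem_avail_iff_univ.2 ⟨hx, h⟩)
    simp [this]
  rw [h0]
  refine Finset.sum_le_sum fun x hx => ?_
  have hxL : L.indicator u x = u x := Set.indicator_of_mem (mem_avail.1 hx).1 u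
  have hterm : ∀ y ∈ avail L (insert x I), u x * shift L I x u y * W (insert y (insert x I)) =
      L.indicator u x * shift Set.univ I x (L.indicator u) y * W (insert y (insert x I)) := by
    intro y hy
    have hyL := (mem_avail.1 hy).1
    rw [hxL]
    by_cases hyI : y ∈ avail L I
    · rw [shift_of_mem hyI, shift_of_mem (avail_subset_univ L I hyI), Set.indicator_of_mem hyL]
    · rw [shift_of_notMem hyI, shift_of_notMem fun h => hyI (mem_avail_iff_univ.2 ⟨h, hyL⟩), hxL]
  rw [Finset.sum_congr rfl hterm]
  refine Finset.sum_le_sum_of_subset_of_nonneg (avail_subset_univ L _) fun y hy hyL => ?_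
  have hyL' : y ∉ L := fun h => hyL (mem_avail_iff_univ.2 ⟨hy, h⟩)
  refine mul_nonneg ?_ (hW _)
  by_cases hyI : y ∈ avail Set.univ I
  · rw [shift_of_mem hyI, Set.indicator_of_notMem hyL', mul_zero]
  · rw [shift_of_notMem hyI]; exact mul_self_nonneg _

/-- Every partial word extends freely, so the border direction acts as the all-ones vector of the
unrestricted letter form. This explains the map `v ↦ L.indicator v + v none • 1`. -/
theorem borderedMatrix_completions_isLorentzian (L : Set X) {I : Finset X} (hI : 2 ≤ Iᶜ.card) :
    (borderedMatrix L completions I).IsLorentzian := by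
  refine (letterMatrix_completions_isLorentzian hI).of_le
    (fun v => L.indicator (fun x => v (some x)) + v none • fun _ => 1) ?_ ?_
  · intro v w s
    ext x
    simp only [Pi.add_apply, Pi.sub_apply, Pi.smul_apply, smul_eq_mul, mul_one]
    by_cases hx : x ∈ L <;> simp only [Set.indicator_of_mem, Set.indicator_of_notMem, hx,
      not_false_eq_true] <;> ring
  · intro v
    set u := L.indicator fun x => v (some x) with hu
    set M := letterMatrix Set.univ completions I with hM
    have hsymm : M.IsSymm := letterMatrix_isSymm _ _ _
    have h1 : u ⬝ᵥ M *ᵥ (fun _ => 1) =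
        ∑ x ∈ avail L I, v (some x) * completions (insert x I) := by
      rw [letterMatrix_completions_mulVec_one hI]
      rw [← Finset.sum_subset (avail_subset_univ L I)]
      · refine Finset.sum_congr rfl fun x hx => ?_
        rw [hu, Set.indicator_of_mem (mem_avail.1 hx).1]
      · intro x hx hxL
        have : x ∉ L := fun h => hxL (mem_avail_iff_univ.2 ⟨hx, h⟩)
        simp [hu, this]
    have h2 : (fun _ => 1) ⬝ᵥ M *ᵥ (fun _ => 1) = completions I := by
      rw [letterMatrix_completions_mulVec_one hI, completions_eq_sum (I := I) (by omega)]
      simp only [one_mul]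
    have h3 := hsymm.dotProduct_mulVec_sub_smul u (fun _ => 1) (-v none)
    rw [h1, h2, neg_smul, sub_neg_eq_add] at h3
    rw [h3, dotProduct_borderedMatrix_mulVec, ← letterForm_eq]
    have := letterForm_le_letterForm_univ L completions_nonneg I fun x => v (some x)
    rw [← hu] at this
    linarith

/-- An `m`-letter word after `z` would, with `z` put in front and its last letter dropped, give an
`m`-letter word from `J`. This is the hypothesis `her` of the induction step. -/
theorem wordSum_completions_insert_eq_zero (L : Set X) (m : ℕ) (J : Finset X)
    (hJ : wordSum L completions m J = 0) (z : X) (hz : z ∈ avail L J) :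
    wordSum L completions m (insert z J) = 0 := by
  induction m generalizing J z with
  | zero => exact absurd hJ (completions_pos J).ne'
  | succ m ih =>
    have h0 := (Finset.sum_eq_zero_iff_of_nonneg
      (fun y _ => wordSum_nonneg L completions_nonneg m _)).1 hJ
    exact Finset.sum_eq_zero fun y hy => ih _ (h0 z hz) y hy

theorem borderedMatrix_wordSum_isLorentzian (L : Set X) (m : ℕ) {I : Finset X}
    (hI : m + 2 ≤ Iᶜ.card) : (borderedMatrix L (wordSum L completions m) I).IsLorentzian := by
  induction m generalizing I with
  | zero => exact borderedMatrix_completions_isLorentzian L (by omega)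
  | succ m ih =>
    refine borderedMatrix_isLorentzian_step L (wordSum_nonneg L completions_nonneg m)
      (fun J => rfl) (wordSum_completions_insert_eq_zero L m) I (ih (by omega)) fun x hx => ih ?_
    have := card_compl_insert (notMem_of_mem_avail hx)
    omega

/-- On all-ones letters and the border vector, the bordered form takes the values of `wordSum` at
lengths `m + 2`, `m + 1` (mixed) and `m`. -/
theorem wordSum_logConcave (L : Set X) (m : ℕ) {I : Finset X} (hI : m + 2 ≤ Iᶜ.card) :
    wordSum L completions m I * wordSum L completions (m + 2) I ≤
      wordSum L completions (m + 1) I ^ 2 := by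
  have h := (borderedMatrix_wordSum_isLorentzian L m hI).mul_le_sq (borderedMatrix_isSymm ..)
    (fun o => o.elim 0 fun _ => 1) (fun o => o.elim 1 fun _ => 0) ?_
  · rw [dotProduct_borderedMatrix_mulVec, dotProduct_borderedMatrix_mulVec, dotProduct,
      Fintype.sum_option] at h
    simp only [Option.elim, borderedMatrix_mulVec_some, letterForm, shift_const] at h
    simp only [mul_one, one_mul, mul_zero, zero_mul, Finset.sum_const_zero, add_zero, zero_add,
      one_pow, Finset.sum_ite_mem, Finset.univ_inter, ne_eq, OfNat.ofNat_ne_zero,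
      not_false_eq_true, zero_pow] at h
    rw [mul_comm]
    exact h
  · rw [dotProduct_borderedMatrix_mulVec]
    simpa [letterForm, shift_const] using wordSum_nonneg L completions_nonneg m I

end Completions

/-! ### Counting linear extensions by words. -/

section Counting

variable {X : Type*} [PartialOrder X] [Fintype X]

/-- The linear extensions of the complement of `I`, with values starting at `#I + 1`, which
exceed `k` outside `L`; they are extended by zero to `I`. -/
def tailExtensions (L : Set X) (k : ℕ) (I : Finset X) : Set (X → ℕ) :=
  {f | (∀ y ∈ I, f y = 0) ∧ Set.BijOn f {y | y ∉ I} (Set.Icc (I.card + 1) (Fintype.card X)) ∧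
    (∀ a b, a ∉ I → b ∉ I → a < b → f a < f b) ∧ ∀ z, z ∉ I → z ∉ L → k < f z}

theorem tailExtensions_finite (L : Set X) (k : ℕ) (I : Finset X) :
    (tailExtensions L k I).Finite := by
  refine (Set.Finite.pi' fun _ : X => Set.finite_Iic (Fintype.card X)).subset fun f hf y => ?_
  by_cases hy : y ∈ I
  · simp [hf.1 y hy]
  · exact (hf.2.1.mapsTo hy).2

theorem tailExtensions_univ (L : Set X) (k : ℕ) :
    tailExtensions L k Finset.univ = {0} := by
  ext f
  constructor
  · intro hf
    ext y
    exact hf.1 y (Finset.mem_univ y)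
  · rintro rfl
    refine ⟨fun _ _ => rfl, ?_, by simp, by simp⟩
    simp

variable [DecidableEq X]

theorem update_mem_tailExtensions {L : Set X} {k : ℕ} {I : Finset X} {y : X}
    (hy : y ∈ avail Set.univ I) (hyk : y ∈ L ∨ k ≤ I.card) {g : X → ℕ}
    (hg : g ∈ tailExtensions L k (insert y I)) :
    Function.update g y (I.card + 1) ∈ tailExtensions L k I := by
  obtain ⟨g0, gb, gm, gk⟩ := hg
  obtain ⟨-, hyI, hyp⟩ := mem_avail.1 hy
  rw [Finset.card_insert_of_notMem hyI] at gb
  have hval : ∀ z, z ∉ I → z ≠ y → z ∉ insert y I := fun z hz hzy => by simp [hz, hzy]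
  have hlt : ∀ z, z ∉ I → z ≠ y → I.card + 2 ≤ g z ∧ g z ≤ Fintype.card X := fun z hz hzy =>
    gb.mapsTo (hval z hz hzy)
  have hcard : I.card + 1 ≤ Fintype.card X := by
    rw [← Finset.card_insert_of_notMem hyI]; exact Finset.card_le_univ _
  refine ⟨fun z hz => ?_, ⟨fun z hz => ?_, fun a ha b hb hab => ?_, fun j hj => ?_⟩,
    fun a b ha hb hab => ?_, fun z hz hzL => ?_⟩
  · have : z ≠ y := by rintro rfl; exact hyI hz
    rw [Function.update_of_ne this, g0 z (Finset.mem_insert_of_mem hz)]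
  · by_cases hzy : z = y
    · subst hzy; simp [hcard]
    · rw [Function.update_of_ne hzy]
      have := hlt z hz hzy
      exact ⟨by omega, this.2⟩
  · by_cases h1 : a = y <;> by_cases h2 : b = y
    · rw [h1, h2]
    · subst h1
      rw [Function.update_self, Function.update_of_ne h2] at hab
      have := hlt b hb h2; omega
    · subst h2
      rw [Function.update_self, Function.update_of_ne h1] at hab
      have := hlt a ha h1; omega
    · rw [Function.update_of_ne h1, Function.update_of_ne h2] at hab
      exact gb.injOn (hval a ha h1) (hval b hb h2) hab
  · by_cases hj1 : j = I.card + 1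
    · exact ⟨y, hyI, by rw [hj1, Function.update_self]⟩
    · obtain ⟨z, hz, rfl⟩ := gb.surjOn (show j ∈ Set.Icc (I.card + 1 + 1) (Fintype.card X) from
        ⟨by have := hj.1; omega, hj.2⟩)
      have hz' : z ≠ y ∧ z ∉ I := by simpa using hz
      exact ⟨z, hz'.2, Function.update_of_ne hz'.1 _ _⟩
  · have h2 : b ≠ y := by rintro rfl; exact ha (hyp a hab)
    rw [Function.update_of_ne h2]
    by_cases h1 : a = y
    · subst h1
      rw [Function.update_self]
      have := hlt b hb h2; omega
    · rw [Function.update_of_ne h1]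
      exact gm a b (hval a ha h1) (hval b hb h2) hab
  · by_cases hzy : z = y
    · subst hzy
      rw [Function.update_self]
      have := hyk.resolve_left hzL; omega
    · rw [Function.update_of_ne hzy]
      exact gk z (hval z hz hzy) hzL

theorem update_zero_mem_tailExtensions {L : Set X} {k : ℕ} {I : Finset X} {y : X} (hyI : y ∉ I)
    {f : X → ℕ} (hf : f ∈ tailExtensions L k I) (hfy : f y = I.card + 1) :
    y ∈ avail Set.univ I ∧ (y ∈ L ∨ k ≤ I.card) ∧
      Function.update f y 0 ∈ tailExtensions L k (insert y I) := by
  obtain ⟨f0, fb, fm, fk⟩ := hf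
  have hsplit : ∀ z, z ∉ insert y I → z ≠ y ∧ z ∉ I := fun z hz => by simpa using hz
  refine ⟨mem_avail.2 ⟨trivial, hyI, fun w hw => ?_⟩, ?_, ?_⟩
  · by_contra hwI
    have h1 := fm w y hwI hyI hw
    have h2 := (fb.mapsTo (show w ∈ {y | y ∉ I} from hwI)).1
    omega
  · by_contra! h
    have := fk y hyI h.1
    omega
  · refine ⟨fun z hz => ?_, ⟨fun z hz => ?_, fun a ha b hb hab => ?_, fun j hj => ?_⟩,
      fun a b ha hb hab => ?_, fun z hz hzL => ?_⟩
    · by_cases hzy : z = y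
      · subst hzy; simp
      · rw [Function.update_of_ne hzy]
        exact f0 z ((Finset.mem_insert.1 hz).resolve_left hzy)
    · obtain ⟨h1, h2⟩ := hsplit z hz
      rw [Function.update_of_ne h1, Finset.card_insert_of_notMem hyI]
      have h3 := fb.mapsTo (show z ∈ {y | y ∉ I} from h2)
      have h4 : f z ≠ f y := fun h => h1 (fb.injOn h2 hyI h)
      exact ⟨by have := h3.1; omega, h3.2⟩
    · obtain ⟨h1, h2⟩ := hsplit a ha
      obtain ⟨h3, h4⟩ := hsplit b hb
      rw [Function.update_of_ne h1, Function.update_of_ne h3] at hab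
      exact fb.injOn h2 h4 hab
    · rw [Finset.card_insert_of_notMem hyI] at hj
      obtain ⟨z, hz, rfl⟩ := fb.surjOn (show j ∈ Set.Icc (I.card + 1) (Fintype.card X) from
        ⟨by have := hj.1; omega, hj.2⟩)
      have hzy : z ≠ y := by rintro rfl; have := hj.1; omega
      exact ⟨z, by simpa using ⟨hzy, hz⟩, Function.update_of_ne hzy _ _⟩
    · obtain ⟨h1, h2⟩ := hsplit a ha
      obtain ⟨h3, h4⟩ := hsplit b hb
      rw [Function.update_of_ne h1, Function.update_of_ne h3]
      exact fm a b h2 h4 hab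
    · obtain ⟨h1, h2⟩ := hsplit z hz
      rw [Function.update_of_ne h1]
      exact fk z h2 hzL

/-- Sort by the element `y` receiving the least value `#I + 1`; outside `L` this is allowed only
when `#I + 1 > k`. The set `s` is left abstract because it becomes `avail L I` before stage `k` and
`avail Set.univ I` afterwards. -/
theorem ncard_tailExtensions_eq_sum (L : Set X) (k : ℕ) {I : Finset X} (hI : Iᶜ.card ≠ 0)
    (s : Finset X) (hs : ∀ y, y ∈ s ↔ y ∈ avail Set.univ I ∧ (y ∈ L ∨ k ≤ I.card)) :
    (tailExtensions L k I).ncard = ∑ y ∈ s, (tailExtensions L k (insert y I)).ncard := by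
  have hfin := fun J : Finset X => (tailExtensions_finite L k J).to_subtype
  let φ : (Σ y : s, tailExtensions L k (insert y.1 I)) → tailExtensions L k I := fun p =>
    ⟨Function.update p.2.1 p.1.1 (I.card + 1), update_mem_tailExtensions
      ((hs _).1 p.1.2).1 ((hs _).1 p.1.2).2 p.2.2⟩
  have hinj : Function.Injective φ := by
    rintro ⟨⟨y, hy⟩, g, hg⟩ ⟨⟨y', hy'⟩, g', hg'⟩ h
    have h0 : Function.update g y (I.card + 1) = Function.update g' y' (I.card + 1) :=
      congrArg Subtype.val h
    have hyI := notMem_of_mem_avail ((hs y).1 hy).1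
    have hyI' := notMem_of_mem_avail ((hs y').1 hy').1
    have hmem : Function.update g y (I.card + 1) ∈ tailExtensions L k I :=
      (φ ⟨⟨y, hy⟩, g, hg⟩).2
    have hyy : y = y' := by
      refine hmem.2.1.injOn hyI hyI' ?_
      rw [Function.update_self]
      conv_rhs => rw [h0]
      rw [Function.update_self]
    subst hyy
    have hgg : g = g' := by
      ext z
      by_cases hz : z = y
      · subst hz
        rw [hg.1 z (Finset.mem_insert_self _ _), hg'.1 z (Finset.mem_insert_self _ _)]
      · have := congrFun h0 z
        rwa [Function.update_of_ne hz, Function.update_of_ne hz] at this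
    subst hgg
    rfl
  have hsurj : Function.Surjective φ := by
    rintro ⟨f, hf⟩
    have hcard : I.card + 1 ≤ Fintype.card X := by
      rw [Finset.card_compl] at hI; omega
    obtain ⟨y, hyI, hfy⟩ := hf.2.1.surjOn (show I.card + 1 ∈ Set.Icc _ _ from ⟨le_rfl, hcard⟩)
    obtain ⟨h1, h2, h3⟩ := update_zero_mem_tailExtensions hyI hf hfy
    refine ⟨⟨⟨y, (hs y).2 ⟨h1, h2⟩⟩, _, h3⟩, Subtype.ext ?_⟩
    change Function.update (Function.update f y 0) y (I.card + 1) = f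
    rw [Function.update_idem, ← hfy, Function.update_eq_self]
  have := Nat.card_congr (Equiv.ofBijective φ ⟨hinj, hsurj⟩)
  rw [Nat.card_sigma] at this
  rw [← Nat.card_coe_set_eq, ← this]
  simp only [Nat.card_coe_set_eq]
  exact Finset.sum_coe_sort s fun y => (tailExtensions L k (insert y I)).ncard

theorem ncard_tailExtensions_of_le (L : Set X) {k : ℕ} {I : Finset X} (hk : k ≤ I.card) :
    ((tailExtensions L k I).ncard : ℝ) = completions I := by
  induction hn : Iᶜ.card generalizing I with
  | zero =>
    have hI : I = Finset.univ := by
      rwa [Finset.card_eq_zero, Finset.compl_eq_empty_iff] at hn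
    rw [completions, hn, wordSum, hI, tailExtensions_univ, Set.ncard_singleton, Nat.cast_one]
  | succ n ih =>
    rw [ncard_tailExtensions_eq_sum L k (by omega) (avail Set.univ I) (by simp [hk]),
      completions_eq_sum (by omega), Nat.cast_sum]
    refine Finset.sum_congr rfl fun y hy => ?_
    have hyI := notMem_of_mem_avail hy
    have := card_compl_insert hyI
    exact ih (by rw [Finset.card_insert_of_notMem hyI]; omega) (by omega)

theorem ncard_tailExtensions (L : Set X) {k : ℕ} (hk : k ≤ Fintype.card X) {m : ℕ}
    {I : Finset X} (hm : I.card + m = k) :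
    ((tailExtensions L k I).ncard : ℝ) = wordSum L completions m I := by
  induction m generalizing I with
  | zero => exact ncard_tailExtensions_of_le L (by omega)
  | succ m ih =>
    rw [ncard_tailExtensions_eq_sum L k (by rw [Finset.card_compl]; omega) (avail L I),
      wordSum, Nat.cast_sum]
    · refine Finset.sum_congr rfl fun y hy => ?_
      exact ih (by rw [Finset.card_insert_of_notMem (notMem_of_mem_avail hy)]; omega)
    · intro y
      rw [mem_avail_iff_univ]
      have : ¬ k ≤ I.card := by omega
      simp [this]

end Counting

/-! ### From counts to probabilities. -/

section LinearExtensions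

open MeasureTheory ProbabilityTheory

variable {X : Type*} [PartialOrder X] [Fintype X]

/-- Everything above `x` takes a larger value than `x`, so the bound at `x` holds on its whole upper
set, the complement of `L`. -/
theorem linearExtensions_inter_lt (x : X) (k : ℕ) :
    linearExtensions X ∩ {f | f x > k} = tailExtensions {z | ¬ x ≤ z} k ∅ := by
  ext f
  simp only [linearExtensions, tailExtensions, Set.mem_inter_iff, Set.mem_ofPred_eq,
    Finset.notMem_empty, not_false_eq_true, Finset.card_empty, zero_add, Set.ofPred_true,
    not_not, forall_true_left, IsEmpty.forall_iff, implies_true, true_and]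
  constructor
  · rintro ⟨⟨hb, hm⟩, hx⟩
    refine ⟨hb, hm, fun z hz => ?_⟩
    rcases hz.eq_or_lt with rfl | hz
    · exact hx
    · exact hx.trans (hm _ _ hz)
  · rintro ⟨hb, hm, hx⟩
    exact ⟨⟨hb, hm⟩, hx x le_rfl⟩

theorem linearExtensions_finite (X : Type*) [PartialOrder X] [Fintype X] :
    (linearExtensions X).Finite :=
  (Set.Finite.pi' fun _ : X => Set.finite_Iic (Fintype.card X)).subset fun _ hf y =>
    (hf.1.mapsTo (Set.mem_univ y)).2

theorem linExtLaw_real (t : Set (X → ℕ)) :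
    (linExtLaw X).real t =
      ((linearExtensions X ∩ t).ncard : ℝ) / (linearExtensions X).ncard := by
  have hfin := linearExtensions_finite X
  rw [Measure.real, linExtLaw, uniformOn, cond_apply hfin.measurableSet,
    Measure.count_apply_finite _ hfin, Measure.count_apply_finite _ (hfin.inter_of_left t),
    Set.ncard_eq_toFinset_card _ hfin, Set.ncard_eq_toFinset_card _ (hfin.inter_of_left t)]
  simp [div_eq_inv_mul]

theorem ncard_linearExtensions_logConcave (x : X) (k : ℕ) (hk : k + 2 ≤ Fintype.card X) :
    ((linearExtensions X ∩ {f | f x > k}).ncard : ℝ) *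
        (linearExtensions X ∩ {f | f x > k + 2}).ncard ≤
      ((linearExtensions X ∩ {f | f x > k + 1}).ncard : ℝ) ^ 2 := by
  classical
  simp only [linearExtensions_inter_lt]
  rw [ncard_tailExtensions _ (k := k) (m := k) (I := ∅) (by omega) (by simp),
    ncard_tailExtensions _ (k := k + 1) (m := k + 1) (I := ∅) (by omega) (by simp),
    ncard_tailExtensions _ (k := k + 2) (m := k + 2) (I := ∅) (by omega) (by simp)]
  exact wordSum_logConcave _ k (by simpa using hk)

theorem ncard_linearExtensions_lt_succ (x : X) (k : ℕ) :
    ((linearExtensions X ∩ {f | f x = k + 1}).ncard : ℝ) +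
        (linearExtensions X ∩ {f | f x > k + 1}).ncard =
      (linearExtensions X ∩ {f | f x > k}).ncard := by
  have hfin := linearExtensions_finite X
  rw [← Nat.cast_add, ← Set.ncard_union_eq _ (hfin.inter_of_left _) (hfin.inter_of_left _)]
  · congr 2
    ext f
    simp only [Set.mem_union, Set.mem_inter_iff, Set.mem_ofPred_eq, ← and_or_left]
    refine and_congr_right fun _ => ?_
    omega
  · refine Set.disjoint_left.2 fun f h1 h2 => ?_
    have := h1.2
    have := h2.2
    simp only [Set.mem_ofPred_eq] at *
    omega

theorem linearExtensions_inter_pos (x : X) :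
    linearExtensions X ∩ {f | f x > 0} = linearExtensions X :=
  Set.inter_eq_left.2 fun _ hf => (hf.1.mapsTo (Set.mem_univ x)).1

end LinearExtensions

theorem corollaryc {X : Type*} [PartialOrder X] [Fintype X] (x : X) :
    (∀ k : ℕ, 1 ≤ k → k ≤ Fintype.card X - 1 →
      (linExtLaw X).real {f | f x > k - 1} * (linExtLaw X).real {f | f x > k + 1} ≤
        (linExtLaw X).real {f | f x > k} ^ 2) ∧
    (linExtLaw X).real {f | f x = 1} * (linExtLaw X).real {f | f x > 1} ≤
      (linExtLaw X).real {f | f x = 2} := by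
  simp only [linExtLaw_real]
  refine ⟨fun k hk1 hkn => ?_, ?_⟩
  -- Writing `k = j + 1` makes the truncated subtraction `k - 1` exact.
  · obtain ⟨j, rfl⟩ := Nat.exists_eq_add_of_le' hk1
    rw [div_mul_div_comm, div_pow, ← sq]
    exact div_le_div_of_nonneg_right
      (ncard_linearExtensions_logConcave x j (by omega)) (sq_nonneg _)
  -- With `N`, `A`, `B` the numbers of extensions with `f x > 0`, `f x > 1`, `f x > 2`, the claim
  -- `(N - A) * A ≤ (A - B) * N` is equivalent to `N * B ≤ A ^ 2`, the case `k = 1` of the first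
  -- part. If `n < 2` that case is not available, but then `B = 0`.
  · have e0 := ncard_linearExtensions_lt_succ x 0
    have e1 := ncard_linearExtensions_lt_succ x 1
    rw [linearExtensions_inter_pos] at e0
    simp only [zero_add, Nat.reduceAdd] at e0 e1
    have key : ((linearExtensions X).ncard : ℝ) * (linearExtensions X ∩ {f | f x > 2}).ncard ≤
        ((linearExtensions X ∩ {f | f x > 1}).ncard : ℝ) ^ 2 := by
      by_cases hn : 2 ≤ Fintype.card X
      · have := ncard_linearExtensions_logConcave x 0 (by omega)
        rwa [linearExtensions_inter_pos] at this
      · have : linearExtensions X ∩ {f | f x > 2} = ∅ := by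
          refine Set.eq_empty_of_forall_notMem fun f hf => ?_
          have h1 := (hf.1.1.mapsTo (Set.mem_univ x)).2
          have h2 : f x > 2 := hf.2
          omega
        rw [this, Set.ncard_empty, Nat.cast_zero, mul_zero]
        positivity
    rcases (Nat.cast_nonneg (α := ℝ) (linearExtensions X).ncard).eq_or_lt with h0 | h0
    · simp [← h0]
    · rw [div_mul_div_comm, div_le_div_iff₀ (mul_pos h0 h0) h0]
      set A := ((linearExtensions X ∩ {f | f x > 1}).ncard : ℝ)
      have h : ((linearExtensions X ∩ {f | f x = 1}).ncard : ℝ) * A ≤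
          (linearExtensions X ∩ {f | f x = 2}).ncard * (linearExtensions X).ncard := by
        rw [eq_sub_of_add_eq e0, eq_sub_of_add_eq e1]
        linarith
      rw [← mul_assoc]
      exact mul_le_mul_of_nonneg_right h h0.le
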